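/- Let $(L_n)_{n\ge 0}$ and $(M_n)_{n\ge 1}$ be bounded sequences of positive real numbers, and let $S^{(1)}=(S^{(1)}_t)_{t\ge0}$ and $S^{(2)}=(S^{(2)}_t)_{t\ge0}$ be two independent continuous-time birth-and-death processes on $\{0,1,2,\dots\}$ with right-continuous paths, both with birth rates $L_n$ (from $n$ to $n+1$, $n\ge0$) and death rates $M_n$ (from $n$ to $n-1$, $n\ge1$), and both started at $S^{(1)}_0=S^{(2)}_0=0$; in particular they are identically distributed. Assume that they are null-recurrent, i.e. each returns to $0$ almost surely after leaving it, and the expected return time is infinite. Let $h>0$ be an arbitrary constant and $$\tau=\inf\{t>0:\ S^{(1)}_{t+h}+S^{(2)}_{t+h}=0\}\qquad(\inf\emptyset=\infty).$$ If the limit $\lim_{n\to\infty}(L_n/M_n)^n$ exists, is finite, and satisfies $$\lim_{n\to\infty}\left(\frac{L_n}{M_n}\right)^n>1,$$ then $\mathsf{P}\{\tau<\infty\}<1$. -/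

import Mathlib

open MeasureTheory ProbabilityTheory Filter
open scoped NNReal ENNReal Topology

/-- The matrix of transition rates of the birth-and-death process on `ℕ` with birth rates `L n`
(`n ≥ 0`) and death rates `M n` (`n ≥ 1`); the value `M 0` is not used. -/
noncomputable def bdRate (L M : ℕ → ℝ) (i j : ℕ) : ℝ :=
  if j = i + 1 then L i
  else if j + 1 = i then M i
  else if j = i then -(L i + if i = 0 then 0 else M i)
  else 0

/-- `p t i j` is a (stochastic) transition function on `ℕ` whose derivative at `t = 0+` is the
birth-and-death rate matrix, i.e. `p t i (i+1) = L i * t + o(t)`, `p t i (i-1) = M i * t + o(t)` and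
`p t i i = 1 - (L i + M i) * t + o(t)` (without `M i` if `i = 0`) as `t → 0+`. -/
structure IsBDTransition (L M : ℕ → ℝ) (p : ℝ≥0 → ℕ → ℕ → ℝ) : Prop where
  nonneg : ∀ t i j, 0 ≤ p t i j
  row_sum : ∀ t i, HasSum (fun j => p t i j) 1
  zero : ∀ i j, p 0 i j = if i = j then 1 else 0
  chapman_kolmogorov : ∀ s t i j, HasSum (fun k => p s i k * p t k j) (p (s + t) i j)
  rate : ∀ i j, Tendsto (fun t : ℝ≥0 => (p t i j - p 0 i j) / (t : ℝ)) (𝓝[>] 0)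
    (𝓝 (bdRate L M i j))

/-- `S` is a continuous-time birth-and-death process with birth rates `L n` and death rates `M n`:
an `ℕ`-valued time-homogeneous Markov process with almost surely right-continuous paths
(for the discrete topology of `ℕ`) whose transition function has the prescribed rates. -/
structure IsBirthDeathProcess {Ω : Type*} [MeasurableSpace Ω] (P : Measure Ω)
    (L M : ℕ → ℝ) (S : ℝ≥0 → Ω → ℕ) : Prop where
  measurable : ∀ t, Measurable (S t)
  rightContinuous : ∀ᵐ ω ∂P, ∀ t, ContinuousWithinAt (fun s => S s ω) (Set.Ici t) t
  markov : ∃ p : ℝ≥0 → ℕ → ℕ → ℝ, IsBDTransition L M p ∧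
    ∀ (n : ℕ) (t : ℕ → ℝ≥0) (x : ℕ → ℕ), Monotone t →
      P.real {ω | ∀ k ≤ n + 1, S (t k) ω = x k} =
        P.real {ω | ∀ k ≤ n, S (t k) ω = x k} * p (t (n + 1) - t n) (x n) (x (n + 1))

/-- The first return time to `0` of a path that starts at `0`: the first time at which the path is
at `0` after having left `0` (it is `∞` if there is no such time). -/
noncomputable def returnTimeZero {Ω : Type*} (S : ℝ≥0 → Ω → ℕ) (ω : Ω) : ℝ≥0∞ :=
  ⨅ (t : ℝ≥0) (_ : S t ω = 0 ∧ ∃ s < t, S s ω ≠ 0), (t : ℝ≥0∞)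

/-- Null recurrence of a process started at `0`: it returns to `0` almost surely, and the expected
return time is infinite. -/
def IsNullRecurrentAtZero {Ω : Type*} [MeasurableSpace Ω] (P : Measure Ω)
    (S : ℝ≥0 → Ω → ℕ) : Prop :=
  (∀ᵐ ω ∂P, returnTimeZero S ω < ∞) ∧ ∫⁻ ω, returnTimeZero S ω ∂P = ∞

/-- `τ = inf {t > 0 : S₁ (t + h) + S₂ (t + h) = 0}`, with `inf ∅ = ∞`. -/
noncomputable def sumReturnTime {Ω : Type*} (S₁ S₂ : ℝ≥0 → Ω → ℕ) (h : ℝ≥0) (ω : Ω) : ℝ≥0∞ :=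
  ⨅ (t : ℝ≥0) (_ : 0 < t ∧ S₁ (t + h) ω + S₂ (t + h) ω = 0), (t : ℝ≥0∞)

/-! The pair of processes is one reversible Markov chain on `ℕ × ℕ`, and the claim is that this
chain is transient. Let `f` be superharmonic for it, with values in `[0, 1]`, `f (0, 0) = 1`, and
generator strictly negative at the origin. The mean of `f` after time `h` is then strictly below
`1`, and optional stopping bounds by this mean the probability of being at the origin at any time
after `h` (`measure_sumReturnTime_lt_one`).

Such an `f` exists because the electrical network of the chain has positive capacity between the
origin and infinity. With reversible measure `π`, the hypothesis forces `L n * π n` to grow at least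
like a power `(n + 1) ^ β`, `β > 0`. Rates are bounded, so every edge leaving the antidiagonal `i +
j = n` upwards has conductance at least a multiple of `(n + 1) ^ β`. The unit flow that is uniform
on antidiagonals puts at most `1 / (n + 1)` on each edge, so its energy is of order `∑ 1 / (n + 1) ^
(1 + β) < ∞`. This bounds from below the Dirichlet form of every function falling from `1` at the
origin to `0` outside a triangle (`exists_bdForm_lower_bound`).

Minimisers on triangles are superharmonic there, and minus their generator at the origin is at least
their energy. A pointwise limit along growing triangles keeps both properties
(`exists_superharmonic`). -/

/-- `p` is a stochastic transition function on `ι` whose derivative at `0+` is the matrix `q`. -/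
structure IsTransitionFunction {ι : Type*} [DecidableEq ι] (q : ι → ι → ℝ)
    (p : ℝ≥0 → ι → ι → ℝ) : Prop where
  nonneg : ∀ t x y, 0 ≤ p t x y
  row_sum : ∀ t x, HasSum (fun y => p t x y) 1
  zero : ∀ x y, p 0 x y = if x = y then 1 else 0
  chapman_kolmogorov : ∀ s t x y, HasSum (fun k => p s x k * p t k y) (p (s + t) x y)
  rate : ∀ x y, Tendsto (fun t : ℝ≥0 => (p t x y - p 0 x y) / (t : ℝ)) (𝓝[>] 0) (𝓝 (q x y))

/-! ### Semigroups with bounded rates and their superharmonic functions -/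

namespace IsTransitionFunction

variable {ι : Type*} [DecidableEq ι] {q : ι → ι → ℝ} {p : ℝ≥0 → ι → ι → ℝ}

theorem le_one (hp : IsTransitionFunction q p) (t : ℝ≥0) (x y : ι) : p t x y ≤ 1 :=
  le_hasSum (hp.row_sum t x) y fun z _ => hp.nonneg t x z

theorem one_sub_diag_add_le (hp : IsTransitionFunction q p) (s t : ℝ≥0) (x : ι) :
    1 - p (s + t) x x ≤ (1 - p s x x) + (1 - p t x x) := by
  have h1 : p s x x * p t x x ≤ p (s + t) x x :=
    le_hasSum (hp.chapman_kolmogorov s t x x) x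
      fun z _ => mul_nonneg (hp.nonneg _ _ _) (hp.nonneg _ _ _)
  nlinarith [mul_nonneg (sub_nonneg.2 (hp.le_one s x x)) (sub_nonneg.2 (hp.le_one t x x))]

theorem one_sub_diag_nsmul_le (hp : IsTransitionFunction q p) (t : ℝ≥0) (x : ι) (n : ℕ) :
    1 - p (n * t) x x ≤ n * (1 - p t x x) := by
  induction n with
  | zero => simp [hp.zero]
  | succ n ih =>
    have h := hp.one_sub_diag_add_le (n * t) t x
    have e : ((n + 1 : ℕ) : ℝ≥0) * t = n * t + t := by push_cast; ring
    rw [e]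
    push_cast
    linarith

/-- The exit probability `1 - p t x x` is subadditive in `t`, so it is at most `t` times its slope
at `0`. With bounded rates the estimate is uniform in `x`, which provides the domination needed
below. -/
theorem one_sub_diag_le (hp : IsTransitionFunction q p) {C : ℝ} {x : ι} (hC : -q x x ≤ C)
    (t : ℝ≥0) : 1 - p t x x ≤ C * t := by
  rcases eq_or_ne t 0 with rfl | ht
  · simp [hp.zero]
  have ht' : 0 < t := pos_iff_ne_zero.2 ht
  have hu : Tendsto (fun n : ℕ => t / ((n : ℝ≥0) + 1)) atTop (𝓝[>] 0) := by
    refine tendsto_nhdsWithin_iff.2 ⟨?_, Eventually.of_forall fun n => ?_⟩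
    · rw [← NNReal.tendsto_coe]
      push_cast
      have := (tendsto_one_div_add_atTop_nhds_zero_nat (𝕜 := ℝ)).const_mul (t : ℝ)
      simpa [div_eq_mul_inv] using this
    · exact div_pos ht' (by positivity)
  have hlim := ((hp.rate x x).comp hu).neg.mul_const (t : ℝ)
  have hle : -q x x * t ≤ C * t := mul_le_mul_of_nonneg_right hC t.2
  refine le_trans (ge_of_tendsto' hlim fun n => ?_) hle
  have h := hp.one_sub_diag_nsmul_le (t / ((n : ℝ≥0) + 1)) x (n + 1)
  have e : ((n + 1 : ℕ) : ℝ≥0) * (t / ((n : ℝ≥0) + 1)) = t := by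
    push_cast
    field_simp
  rw [e] at h
  refine h.trans (le_of_eq ?_)
  have ht'' : (t : ℝ) ≠ 0 := by exact_mod_cast ht
  have hn : ((n : ℝ) + 1) ≠ 0 := by positivity
  simp only [Function.comp, hp.zero, if_true]
  push_cast
  field_simp
  ring

theorem summable_mul (hp : IsTransitionFunction q p) {f : ι → ℝ} {B : ℝ} (hf : ∀ x, |f x| ≤ B)
    (t : ℝ≥0) (x : ι) : Summable fun y => p t x y * f y := by
  refine Summable.of_norm_bounded ((hp.row_sum t x).summable.mul_right B) fun y => ?_
  rw [Real.norm_eq_abs, abs_mul, abs_of_nonneg (hp.nonneg t x y)]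
  exact mul_le_mul_of_nonneg_left (hf y) (hp.nonneg t x y)

theorem tsum_mul_mem (hp : IsTransitionFunction q p) {f : ι → ℝ} (h0 : ∀ x, 0 ≤ f x)
    (h1 : ∀ x, f x ≤ 1) (t : ℝ≥0) (x : ι) :
    0 ≤ ∑' y, p t x y * f y ∧ ∑' y, p t x y * f y ≤ 1 := by
  have hf : ∀ x, |f x| ≤ 1 := fun x => abs_le.2 ⟨by linarith [h0 x], h1 x⟩
  refine ⟨tsum_nonneg fun y => mul_nonneg (hp.nonneg _ _ _) (h0 y), ?_⟩
  rw [← (hp.row_sum t x).tsum_eq]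
  exact (hp.summable_mul hf t x).tsum_le_tsum
    (fun y => mul_le_of_le_one_right (hp.nonneg _ _ _) (h1 y)) (hp.row_sum t x).summable

theorem tsum_zero_mul (hp : IsTransitionFunction q p) (f : ι → ℝ) (x : ι) :
    ∑' y, p 0 x y * f y = f x := by
  rw [tsum_eq_single x]
  · simp [hp.zero]
  · intro y hy
    simp [hp.zero, hy.symm]

theorem abs_tsum_sub_le (hp : IsTransitionFunction q p) {f : ι → ℝ} (h0 : ∀ x, 0 ≤ f x)
    (h1 : ∀ x, f x ≤ 1) (t : ℝ≥0) (x : ι) :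
    |∑' y, p t x y * f y - f x| ≤ 1 - p t x x := by
  have hf : ∀ x, |f x| ≤ 1 := fun x => abs_le.2 ⟨by linarith [h0 x], h1 x⟩
  have hs := (hp.summable_mul hf t x).hasSum
  have hrow := hp.row_sum t x
  have hu : HasSum (fun y => if y = x then p t x x * (1 - f x) else 0) (p t x x * (1 - f x)) :=
    hasSum_ite_eq x _
  have hv : HasSum (fun y => if y = x then p t x x * f x else 0) (p t x x * f x) :=
    hasSum_ite_eq x _
  have hlow : p t x x * f x ≤ ∑' y, p t x y * f y :=
    le_hasSum hs x fun z _ => mul_nonneg (hp.nonneg _ _ _) (h0 z)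
  -- This is the bound `hlow` applied to `1 - f`.
  have hupp : p t x x * (1 - f x) ≤ 1 - ∑' y, p t x y * f y := by
    refine le_trans (le_of_eq ?_) (le_hasSum (hrow.sub hs) x fun z _ => ?_)
    · ring
    · nlinarith [hp.nonneg t x z, h1 z, mul_nonneg (hp.nonneg t x z) (sub_nonneg.2 (h1 z))]
  have hd := sub_nonneg.2 (hp.le_one t x x)
  rw [abs_le]
  constructor
  · nlinarith [mul_nonneg hd (sub_nonneg.2 (h1 x))]
  · nlinarith [mul_nonneg hd (h0 x)]

theorem tsum_add_mul (hp : IsTransitionFunction q p) {f : ι → ℝ} (h0 : ∀ x, 0 ≤ f x)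
    (h1 : ∀ x, f x ≤ 1) (s t : ℝ≥0) (x : ι) :
    ∑' y, p (s + t) x y * f y = ∑' k, p s x k * ∑' y, p t k y * f y := by
  have hf : ∀ x, |f x| ≤ 1 := fun x => abs_le.2 ⟨by linarith [h0 x], h1 x⟩
  have hact : ∀ k, |∑' y, p t k y * f y| ≤ 1 := fun k => by
    obtain ⟨a, b⟩ := hp.tsum_mul_mem h0 h1 t k
    exact abs_le.2 ⟨by linarith, b⟩
  let g : ι × ι → ℝ := fun z => p s x z.1 * (p t z.1 z.2 * f z.2)
  have hnn : 0 ≤ g := fun z =>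
    mul_nonneg (hp.nonneg _ _ _) (mul_nonneg (hp.nonneg _ _ _) (h0 z.2))
  have hrow : ∀ k, Summable fun y => g (k, y) := fun k =>
    (hp.summable_mul hf t k).mul_left (p s x k)
  have hcol : Summable fun k => ∑' y, g (k, y) := by
    have e : (fun k => ∑' y, g (k, y)) = fun k => p s x k * ∑' y, p t k y * f y :=
      funext fun k => (hp.summable_mul hf t k).tsum_mul_left (p s x k)
    rw [e]
    exact hp.summable_mul hact s x
  have hsum : Summable g := (summable_prod_of_nonneg hnn).2 ⟨hrow, hcol⟩
  have hcomm : ∑' y, ∑' k, g (k, y) = ∑' k, ∑' y, g (k, y) :=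
    Summable.tsum_comm (f := fun k y => g (k, y)) hsum
  simp_rw [← tsum_mul_left]
  refine Eq.trans ?_ hcomm
  refine tsum_congr fun y => ?_
  rw [← (hp.chapman_kolmogorov s t x y).tsum_eq, ← tsum_mul_right]
  exact tsum_congr fun k => by ring

/-- The generator, evaluated at a bounded function, when the row `q x` is carried by `r`. -/
theorem tendsto_slope_zero (hp : IsTransitionFunction q p) {f : ι → ℝ} (h0 : ∀ x, 0 ≤ f x)
    (h1 : ∀ x, f x ≤ 1) {x : ι} {r : Finset ι} (hx : x ∈ r) (hr : ∑ y ∈ r, q x y = 0) :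
    Tendsto (fun t : ℝ≥0 => (∑' y, p t x y * f y - f x) / (t : ℝ)) (𝓝[>] 0)
      (𝓝 (∑ y ∈ r, q x y * f y)) := by
  have hf : ∀ x, |f x| ≤ 1 := fun x => abs_le.2 ⟨by linarith [h0 x], h1 x⟩
  have hfx : ∑ y ∈ r, p 0 x y * f y = f x := by
    simp [hp.zero, hx]
  have hone : ∑ y ∈ r, p 0 x y = 1 := by simp [hp.zero, hx]
  have hlow : Tendsto (fun t : ℝ≥0 => ∑ y ∈ r, (p t x y - p 0 x y) / (t : ℝ) * f y) (𝓝[>] 0)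
      (𝓝 (∑ y ∈ r, q x y * f y)) :=
    tendsto_finsetSum _ fun y _ => (hp.rate x y).mul_const _
  have hrest : Tendsto (fun t : ℝ≥0 => ∑ y ∈ r, (p t x y - p 0 x y) / (t : ℝ)) (𝓝[>] 0)
      (𝓝 0) := by
    rw [← hr]
    exact tendsto_finsetSum _ fun y _ => hp.rate x y
  have hupp := hlow.sub hrest
  rw [sub_zero] at hupp
  have e1 : ∀ t : ℝ≥0, ∑ y ∈ r, (p t x y - p 0 x y) / (t : ℝ) * f y
      = (∑ y ∈ r, p t x y * f y - f x) / (t : ℝ) := fun t => by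
    rw [← hfx, ← Finset.sum_sub_distrib, Finset.sum_div]
    exact Finset.sum_congr rfl fun y _ => by ring
  have e2 : ∀ t : ℝ≥0, ∑ y ∈ r, (p t x y - p 0 x y) / (t : ℝ)
      = (∑ y ∈ r, p t x y - 1) / (t : ℝ) := fun t => by
    rw [← hone, ← Finset.sum_sub_distrib, Finset.sum_div]
  -- Dropping the states outside `r` bounds the mean of `f` from below, and that of `1 - f` from
  -- below as well. Since the row `q x` sums to `0` over `r`, the two bounds have the same
  -- derivative at `0`.
  refine tendsto_of_tendsto_of_tendsto_of_le_of_le hlow hupp (fun t => ?_) fun t => ?_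
  · simp only [e1]
    have := (hp.summable_mul hf t x).sum_le_tsum r
      fun y _ => mul_nonneg (hp.nonneg t x y) (h0 y)
    gcongr
  · simp only [e1, e2]
    rw [← sub_div]
    have hs := (hp.row_sum t x).sub (hp.summable_mul hf t x).hasSum
    have := sum_le_hasSum r (fun y _ => by
      nlinarith [mul_nonneg (hp.nonneg t x y) (sub_nonneg.2 (h1 y))]) hs
    rw [Finset.sum_sub_distrib] at this
    exact div_le_div_of_nonneg_right (by linarith) t.2

variable {r : ι → Finset ι}

/-- Forward equation for the mean of `f`: Chapman–Kolmogorov reduces the slope at `t` to slopes at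
`0`, and the uniform bound `C` permits dominated convergence over the intermediate state. -/
theorem tendsto_slope (hp : IsTransitionFunction q p) {f : ι → ℝ} (h0 : ∀ x, 0 ≤ f x)
    (h1 : ∀ x, f x ≤ 1) (hx : ∀ x, x ∈ r x) (hr : ∀ x, ∑ y ∈ r x, q x y = 0)
    {C : ℝ} (hC : ∀ x, -q x x ≤ C) (t : ℝ≥0) (x : ι) :
    Tendsto (fun s : ℝ≥0 => (∑' y, p (t + s) x y * f y - ∑' y, p t x y * f y) / (s : ℝ)) (𝓝[>] 0)
      (𝓝 (∑' k, p t x k * ∑ y ∈ r k, q k y * f y)) := by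
  have hf : ∀ x, |f x| ≤ 1 := fun x => abs_le.2 ⟨by linarith [h0 x], h1 x⟩
  have key : Tendsto (fun s : ℝ≥0 => ∑' k, p t x k * ((∑' y, p s k y * f y - f k) / (s : ℝ)))
      (𝓝[>] 0) (𝓝 (∑' k, p t x k * ∑ y ∈ r k, q k y * f y)) := by
    refine tendsto_tsum_of_dominated_convergence ((hp.row_sum t x).summable.mul_right C)
      (fun k => (hp.tendsto_slope_zero h0 h1 (hx k) (hr k)).const_mul _) ?_
    filter_upwards [self_mem_nhdsWithin] with s hs k
    have hs' : (0 : ℝ) < s := hs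
    rw [Real.norm_eq_abs, abs_mul, abs_of_nonneg (hp.nonneg t x k), abs_div, abs_of_pos hs']
    refine mul_le_mul_of_nonneg_left ?_ (hp.nonneg t x k)
    rw [div_le_iff₀ hs']
    exact (hp.abs_tsum_sub_le h0 h1 s k).trans (hp.one_sub_diag_le (hC k) s)
  refine key.congr fun s => ?_
  have hsum : Summable fun k => p t x k * ∑' y, p s k y * f y := by
    refine hp.summable_mul (B := 1) (fun k => ?_) t x
    obtain ⟨a, b⟩ := hp.tsum_mul_mem h0 h1 s k
    exact abs_le.2 ⟨by linarith, b⟩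
  rw [hp.tsum_add_mul h0 h1, ← hsum.tsum_sub (hp.summable_mul hf t x), div_eq_mul_inv,
    ← tsum_mul_right]
  exact tsum_congr fun k => by ring

theorem abs_tsum_add_sub_le (hp : IsTransitionFunction q p) {f : ι → ℝ} (h0 : ∀ x, 0 ≤ f x)
    (h1 : ∀ x, f x ≤ 1) {C : ℝ} (hC : ∀ x, -q x x ≤ C) (t s : ℝ≥0) (x : ι) :
    |∑' y, p (t + s) x y * f y - ∑' y, p t x y * f y| ≤ C * s := by
  have hf : ∀ x, |f x| ≤ 1 := fun x => abs_le.2 ⟨by linarith [h0 x], h1 x⟩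
  have hb : ∀ k, |∑' y, p s k y * f y - f k| ≤ C * s := fun k =>
    (hp.abs_tsum_sub_le h0 h1 s k).trans (hp.one_sub_diag_le (hC k) s)
  have hsum : Summable fun k => p t x k * ∑' y, p s k y * f y := by
    refine hp.summable_mul (B := 1) (fun k => ?_) t x
    obtain ⟨a, b⟩ := hp.tsum_mul_mem h0 h1 s k
    exact abs_le.2 ⟨by linarith, b⟩
  rw [hp.tsum_add_mul h0 h1, ← hsum.tsum_sub (hp.summable_mul hf t x)]
  have hC' := (hp.row_sum t x).mul_right (C * s)
  rw [one_mul] at hC'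
  rw [← Real.norm_eq_abs]
  refine tsum_of_norm_bounded hC' fun k => ?_
  rw [← mul_sub, Real.norm_eq_abs, abs_mul, abs_of_nonneg (hp.nonneg t x k)]
  exact mul_le_mul_of_nonneg_left (hb k) (hp.nonneg t x k)

/-- A `[0, 1]`-valued superharmonic function decreases along the semigroup. -/
theorem antitone_tsum (hp : IsTransitionFunction q p) {f : ι → ℝ} (h0 : ∀ x, 0 ≤ f x)
    (h1 : ∀ x, f x ≤ 1) (hx : ∀ x, x ∈ r x) (hr : ∀ x, ∑ y ∈ r x, q x y = 0)
    {C : ℝ} (hC : ∀ x, -q x x ≤ C) (hG : ∀ x, ∑ y ∈ r x, q x y * f y ≤ 0) (x : ι) :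
    Antitone fun t => ∑' y, p t x y * f y := by
  intro a b hab
  set u : ℝ → ℝ := fun t => ∑' y, p t.toNNReal x y * f y with hu
  have hua : u a = ∑' y, p a x y * f y := by simp [hu]
  have hub : u b = ∑' y, p b x y * f y := by simp [hu]
  have hlip : ∀ s t : ℝ≥0, s ≤ t → |u t - u s| ≤ C * (t - s) := by
    intro s t hst
    have := hp.abs_tsum_add_sub_le h0 h1 hC s (t - s) x
    rw [add_tsub_cancel_of_le hst, NNReal.coe_sub hst] at this
    simpa [hu] using this
  have hC0 : 0 ≤ C := by
    have := (abs_nonneg _).trans (hlip 0 1 zero_le_one)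
    simpa using this
  have hcont : ContinuousOn u (Set.Icc a b) := by
    have : LipschitzOnWith C.toNNReal u (Set.Icc a b) := by
      refine LipschitzOnWith.of_dist_le_mul fun s hs t ht => ?_
      have hs0 : 0 ≤ s := a.2.trans hs.1
      have ht0 : 0 ≤ t := a.2.trans ht.1
      lift s to ℝ≥0 using hs0
      lift t to ℝ≥0 using ht0
      rw [Real.coe_toNNReal _ hC0, Real.dist_eq, Real.dist_eq]
      rcases le_total s t with h | h
      · rw [abs_sub_comm, abs_sub_comm (s : ℝ),
          abs_of_nonneg (a := (t : ℝ) - s) (sub_nonneg.2 (by exact_mod_cast h))]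
        exact hlip s t h
      · rw [abs_of_nonneg (a := (s : ℝ) - t) (sub_nonneg.2 (by exact_mod_cast h))]
        exact hlip t s h
    exact this.continuousOn
  -- Only right derivatives are at hand; for a continuous function, a nonpositive right derivative
  -- already gives monotonicity.
  have main := image_le_of_liminf_slope_right_le_deriv_boundary (f := u) (a := a) (b := b) hcont
    (B := fun t => u a) (B' := fun _ => 0) le_rfl continuousOn_const
    (fun t _ => hasDerivWithinAt_const _ _ _) fun t ht ρ hρ => ?_
  · have := main (Set.right_mem_Icc.2 (by exact_mod_cast hab))
    rw [hua, hub] at this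
    exact this
  · have ht0 : 0 ≤ t := a.2.trans ht.1
    lift t to ℝ≥0 using ht0
    have hmap : Tendsto (fun s : ℝ≥0 => (t : ℝ) + s) (𝓝[>] 0) (𝓝[>] (t : ℝ)) := by
      refine tendsto_nhdsWithin_iff.2 ⟨?_, ?_⟩
      · have : Tendsto (fun s : ℝ≥0 => (t : ℝ) + s) (𝓝 0) (𝓝 ((t : ℝ) + (0 : ℝ≥0))) :=
          (continuous_const.add NNReal.continuous_coe).tendsto 0
        simpa using this.mono_left nhdsWithin_le_nhds
      · filter_upwards [self_mem_nhdsWithin] with s hs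
        have hs' : (0 : ℝ) < s := hs
        simpa using hs'
    have hlim := hp.tendsto_slope h0 h1 hx hr hC t x
    have hneg : ∑' k, p t x k * ∑ y ∈ r k, q k y * f y ≤ 0 :=
      tsum_nonpos fun k => mul_nonpos_of_nonneg_of_nonpos (hp.nonneg _ _ _) (hG k)
    have hev := hlim.eventually_lt_const (hneg.trans_lt hρ)
    refine hmap.frequently (Eventually.frequently ?_)
    filter_upwards [hev] with s hs
    have e : (t : ℝ) + s = ((t + s : ℝ≥0) : ℝ) := by push_cast; rfl
    rw [slope_def_field, e]
    simpa [hu] using hs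

/-- A `[0, 1]`-valued superharmonic function strictly decreases along the semigroup at a point
where it is not harmonic. -/
theorem tsum_lt (hp : IsTransitionFunction q p) {f : ι → ℝ} (h0 : ∀ x, 0 ≤ f x)
    (h1 : ∀ x, f x ≤ 1) (hx : ∀ x, x ∈ r x) (hr : ∀ x, ∑ y ∈ r x, q x y = 0)
    {C : ℝ} (hC : ∀ x, -q x x ≤ C) (hG : ∀ x, ∑ y ∈ r x, q x y * f y ≤ 0) {x : ι}
    (hlt : ∑ y ∈ r x, q x y * f y < 0) {t : ℝ≥0} (ht : 0 < t) :
    ∑' y, p t x y * f y < f x := by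
  have hev := (hp.tendsto_slope_zero h0 h1 (hx x) (hr x)).eventually_lt_const hlt
  have hev2 : ∀ᶠ s : ℝ≥0 in 𝓝[>] 0, s < t :=
    (eventually_lt_nhds ht).filter_mono nhdsWithin_le_nhds
  obtain ⟨s, ⟨hs, hst⟩, hs0⟩ := ((hev.and hev2).and self_mem_nhdsWithin).exists
  have hs' : (0 : ℝ) < s := hs0
  refine (hp.antitone_tsum h0 h1 hx hr hC hG x hst.le).trans_lt ?_
  have := (div_lt_iff₀ hs').1 hs
  simpa using this

end IsTransitionFunction


/-! ### The pair of independent processes as one Markov chain -/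

/-- The generator of the birth-and-death process with rates `L`, `M`. -/
noncomputable def bdGenerator (L M : ℕ → ℝ) (g : ℕ → ℝ) (i : ℕ) : ℝ :=
  L i * (g (i + 1) - g i) + if i = 0 then 0 else M i * (g (i - 1) - g i)

/-- The generator of a pair of independent birth-and-death processes with rates `L`, `M`. -/
noncomputable def bdGenerator₂ (L M : ℕ → ℝ) (f : ℕ × ℕ → ℝ) (x : ℕ × ℕ) : ℝ :=
  bdGenerator L M (fun k => f (k, x.2)) x.1 + bdGenerator L M (fun l => f (x.1, l)) x.2

theorem sum_range_bdRate_mul (L M : ℕ → ℝ) (g : ℕ → ℝ) (i : ℕ) :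
    ∑ k ∈ Finset.range (i + 2), bdRate L M i k * g k = bdGenerator L M g i := by
  rcases i with _ | i
  · simp [bdRate, bdGenerator, Finset.sum_range_succ]
    ring
  · rw [Finset.sum_range_succ, Finset.sum_range_succ, Finset.sum_range_succ,
      Finset.sum_eq_zero fun k hk => ?_]
    · have h : i ≠ i + 1 + 1 := by omega
      simp [bdRate, bdGenerator, h]
      ring
    · have := Finset.mem_range.1 hk
      have h1 : k ≠ i + 1 + 1 := by omega
      have h2 : k + 1 ≠ i + 1 := by omega
      have h3 : k ≠ i + 1 := by omega
      simp [bdRate, h1, h3, this.ne]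

/-- The rate matrix of a pair of independent birth-and-death processes. -/
noncomputable def bdRate₂ (L M : ℕ → ℝ) (x y : ℕ × ℕ) : ℝ :=
  bdRate L M x.1 y.1 * (if x.2 = y.2 then 1 else 0) +
    (if x.1 = y.1 then 1 else 0) * bdRate L M x.2 y.2

theorem sum_bdRate₂_mul (L M : ℕ → ℝ) (f : ℕ × ℕ → ℝ) (x : ℕ × ℕ) :
    ∑ y ∈ Finset.range (x.1 + 2) ×ˢ Finset.range (x.2 + 2), bdRate₂ L M x y * f y =
      bdGenerator₂ L M f x := by
  obtain ⟨i, j⟩ := x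
  have hi : i < i + 2 := by omega
  have hj : j < j + 2 := by omega
  simp only [bdRate₂, bdGenerator₂, ← sum_range_bdRate_mul, add_mul, Finset.sum_add_distrib]
  congr 1
  · rw [Finset.sum_product]
    refine Finset.sum_congr rfl fun k _ => ?_
    simp [hj]
  · rw [Finset.sum_product_right]
    refine Finset.sum_congr rfl fun k _ => ?_
    simp [hi]

theorem sum_bdRate₂ (L M : ℕ → ℝ) (x : ℕ × ℕ) :
    ∑ y ∈ Finset.range (x.1 + 2) ×ˢ Finset.range (x.2 + 2), bdRate₂ L M x y = 0 := by
  have := sum_bdRate₂_mul L M (fun _ => 1) x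
  simpa [bdGenerator₂, bdGenerator] using this

theorem neg_bdRate₂_self_le {L M : ℕ → ℝ} {C : ℝ} (hL : ∀ n, 0 < L n)
    (hC : ∀ n, L n ≤ C ∧ M n ≤ C) (x : ℕ × ℕ) : -bdRate₂ L M x x ≤ 4 * C := by
  have h : ∀ i, -bdRate L M i i ≤ 2 * C := fun i => by
    have h0 := hL i
    have := hC i
    rcases i with _ | i
    · simp [bdRate]
      linarith
    · simp [bdRate]
      linarith
  have h1 := h x.1
  have h2 := h x.2
  simp only [bdRate₂, if_true]
  linarith

/-- The rates come from the product rule at `t = 0`. The two transition functions may differ, so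
uniqueness for given rates is not needed. -/
theorem IsBDTransition.isTransitionFunction_prod {L M : ℕ → ℝ} {p₁ p₂ : ℝ≥0 → ℕ → ℕ → ℝ}
    (h₁ : IsBDTransition L M p₁) (h₂ : IsBDTransition L M p₂) :
    IsTransitionFunction (bdRate₂ L M)
      fun t (x y : ℕ × ℕ) => p₁ t x.1 y.1 * p₂ t x.2 y.2 where
  nonneg t x y := mul_nonneg (h₁.nonneg _ _ _) (h₂.nonneg _ _ _)
  row_sum t x := by
    have := (h₁.row_sum t x.1).mul (h₂.row_sum t x.2)
      ((h₁.row_sum t x.1).summable.mul_of_nonneg (h₂.row_sum t x.2).summable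
        (fun _ => h₁.nonneg _ _ _) fun _ => h₂.nonneg _ _ _)
    simpa using this
  zero x y := by
    rw [h₁.zero, h₂.zero]
    by_cases h : x.1 = y.1 <;> by_cases h' : x.2 = y.2 <;> simp [Prod.ext_iff, h, h']
  chapman_kolmogorov s t x y := by
    have e₁ := h₁.chapman_kolmogorov s t x.1 y.1
    have e₂ := h₂.chapman_kolmogorov s t x.2 y.2
    have := e₁.mul e₂ (e₁.summable.mul_of_nonneg e₂.summable
      (fun _ => mul_nonneg (h₁.nonneg _ _ _) (h₁.nonneg _ _ _))
      fun _ => mul_nonneg (h₂.nonneg _ _ _) (h₂.nonneg _ _ _))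
    have e : (fun k : ℕ × ℕ => p₁ s x.1 k.1 * p₂ s x.2 k.2 * (p₁ t k.1 y.1 * p₂ t k.2 y.2)) =
        fun k => p₁ s x.1 k.1 * p₁ t k.1 y.1 * (p₂ s x.2 k.2 * p₂ t k.2 y.2) :=
      funext fun k => by ring
    rw [e]
    exact this
  rate x y := by
    have hid : Tendsto (fun t : ℝ≥0 => (t : ℝ)) (𝓝[>] 0) (𝓝 0) := by
      have : Tendsto (fun t : ℝ≥0 => (t : ℝ)) (𝓝 0) (𝓝 ((0 : ℝ≥0) : ℝ)) :=
        NNReal.continuous_coe.tendsto 0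
      simpa using this.mono_left nhdsWithin_le_nhds
    have hc : Tendsto (fun t : ℝ≥0 => p₂ t x.2 y.2) (𝓝[>] 0) (𝓝 (p₂ 0 x.2 y.2)) := by
      have := ((h₂.rate x.2 y.2).mul hid).add_const (p₂ 0 x.2 y.2)
      rw [mul_zero, zero_add] at this
      refine this.congr' ?_
      filter_upwards [self_mem_nhdsWithin] with t ht
      have ht' : (t : ℝ) ≠ 0 := NNReal.coe_ne_zero.2 (ne_of_gt ht)
      rw [div_mul_cancel₀ _ ht', sub_add_cancel]
    have := ((h₁.rate x.1 y.1).mul hc).add ((h₂.rate x.2 y.2).const_mul (p₁ 0 x.1 y.1))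
    have e : bdRate₂ L M x y = bdRate L M x.1 y.1 * p₂ 0 x.2 y.2 +
        p₁ 0 x.1 y.1 * bdRate L M x.2 y.2 := by
      rw [bdRate₂, h₁.zero, h₂.zero]
    rw [e]
    refine this.congr fun t => ?_
    ring

/-! ### Hitting probabilities of the origin -/

section Hitting

variable {Ω : Type*} [MeasurableSpace Ω] {P : Measure Ω}

/-- A Markov chain started from a given path visits `o` at one of the next `r` steps with
probability at most the mean value of a superharmonic function `f` with `1 ≤ f o` after one step. -/
theorem measure_prefix_hit_le {ι : Type*} [Countable ι] (X : ℕ → Ω → ι)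
    (K : ℕ → ι → ι → ℝ≥0∞) (f : ι → ℝ≥0∞) (o : ι) (ho : 1 ≤ f o)
    (hX : ∀ (n : ℕ) (x : ℕ → ι), P {ω | ∀ k ≤ n + 1, X k ω = x k} =
      P {ω | ∀ k ≤ n, X k ω = x k} * K n (x n) (x (n + 1)))
    (hK : ∀ n x, ∑' y, K n x y * f y ≤ f x) (r m : ℕ) (x : ℕ → ι) :
    P {ω | (∀ k ≤ m, X k ω = x k) ∧ ∃ k, m < k ∧ k ≤ m + r ∧ X k ω = o} ≤
      P {ω | ∀ k ≤ m, X k ω = x k} * ∑' y, K m (x m) y * f y := by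
  induction r generalizing m x with
  | zero =>
    refine le_trans (le_of_eq ?_) zero_le
    convert measure_empty (μ := P)
    ext ω
    simp only [Set.mem_ofPred_eq, Set.mem_empty_iff_false, iff_false]
    rintro ⟨-, k, hk, hk', -⟩
    omega
  | succ r ih =>
    have hpre : ∀ y, {ω | ∀ k ≤ m + 1, X k ω = Function.update x (m + 1) y k} =
        {ω | (∀ k ≤ m, X k ω = x k) ∧ X (m + 1) ω = y} := fun y => by
      ext ω
      simp only [Set.mem_ofPred_eq]
      constructor
      · intro h
        refine ⟨fun k hk => ?_, ?_⟩
        · have := h k (by omega)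
          rwa [Function.update_of_ne (by omega)] at this
        · simpa using h (m + 1) le_rfl
      · rintro ⟨h, h'⟩ k hk
        rcases eq_or_ne k (m + 1) with rfl | hne
        · simpa using h'
        · rw [Function.update_of_ne hne]
          exact h k (by omega)
    have hprob : ∀ y, P {ω | (∀ k ≤ m, X k ω = x k) ∧ X (m + 1) ω = y} =
        P {ω | ∀ k ≤ m, X k ω = x k} * K m (x m) y := fun y => by
      rw [← hpre, hX m, Function.update_self, Function.update_of_ne (by omega)]
      congr 2
      ext ω
      refine forall₂_congr fun k hk => ?_
      rw [Function.update_of_ne (by omega)]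
    have hterm : ∀ y, P {ω | ((∀ k ≤ m, X k ω = x k) ∧ X (m + 1) ω = y) ∧
        ∃ k, m < k ∧ k ≤ m + (r + 1) ∧ X k ω = o} ≤
        P {ω | ∀ k ≤ m, X k ω = x k} * (K m (x m) y * f y) := fun y => by
      rw [← mul_assoc, ← hprob]
      -- If the step lands on `o`, the visit has occurred and `f o ≥ 1` pays for it. Otherwise the
      -- induction hypothesis gives the mean of `f` one step later, at most `f y` by
      -- superharmonicity.
      rcases eq_or_ne y o with rfl | hy
      · exact (measure_mono fun ω hω => hω.1).trans (le_mul_of_one_le_right' ho)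
      · have := ih (m + 1) (Function.update x (m + 1) y)
        rw [hpre, Function.update_self] at this
        refine (measure_mono ?_).trans (this.trans ?_)
        · rintro ω ⟨hω, k, hk, hk', hko⟩
          have hne : k ≠ m + 1 := by
            rintro rfl
            exact hy (hω.2.symm.trans hko)
          have hω' : ω ∈ {ω | ∀ k ≤ m + 1, X k ω = Function.update x (m + 1) y k} := by
            rw [hpre]
            exact hω
          exact ⟨hω', k, by omega, by omega, hko⟩
        · gcongr
          exact hK _ _
    rw [← ENNReal.tsum_mul_left]
    refine le_trans ?_ (ENNReal.tsum_le_tsum hterm)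
    refine le_trans (measure_mono ?_) (measure_iUnion_le _)
    rintro ω ⟨hω, hk⟩
    exact Set.mem_iUnion.2 ⟨X (m + 1) ω, ⟨hω, rfl⟩, hk⟩

theorem measure_pair_path_eq {S₁ S₂ : ℝ≥0 → Ω → ℕ}
    (hindep : IndepFun (fun ω t => S₁ t ω) (fun ω t => S₂ t ω) P)
    (t : ℕ → ℝ≥0) (x : ℕ → ℕ × ℕ) (n : ℕ) :
    P {ω | ∀ k ≤ n, (S₁ (t k) ω, S₂ (t k) ω) = x k} =
      P {ω | ∀ k ≤ n, S₁ (t k) ω = (x k).1} * P {ω | ∀ k ≤ n, S₂ (t k) ω = (x k).2} := by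
  have hms : ∀ y : ℕ → ℕ, MeasurableSet {g : ℝ≥0 → ℕ | ∀ k ≤ n, g (t k) = y k} := fun y => by
    have : {g : ℝ≥0 → ℕ | ∀ k ≤ n, g (t k) = y k} =
        ⋂ k, ⋂ (_ : k ≤ n), (fun g : ℝ≥0 → ℕ => g (t k)) ⁻¹' {y k} := by
      ext g
      simp
    rw [this]
    exact MeasurableSet.iInter fun k => MeasurableSet.iInter fun _ =>
      measurable_pi_apply (t k) (measurableSet_singleton _)
  have := hindep.measure_inter_preimage_eq_mul _ _ (hms fun k => (x k).1) (hms fun k => (x k).2)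
  refine Eq.trans (congrArg P ?_) this
  ext ω
  simp only [Set.mem_ofPred_eq, Set.mem_inter_iff, Set.mem_preimage, Prod.ext_iff]
  exact ⟨fun h => ⟨fun k hk => (h k hk).1, fun k hk => (h k hk).2⟩,
    fun h k hk => ⟨h.1 k hk, h.2 k hk⟩⟩

theorem exists_grid_zero {s : ℝ≥0 → ℕ} {h t : ℝ≥0}
    (hs : ContinuousWithinAt s (Set.Ici (t + h)) (t + h)) :
    ∀ᶠ N : ℕ in atTop, ∀ k : ℕ, t ≤ k / ((N : ℝ≥0) + 1) →
      k / ((N : ℝ≥0) + 1) ≤ t + 1 / ((N : ℝ≥0) + 1) → s (h + k / ((N : ℝ≥0) + 1)) = s (t + h) := by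
  have h1 : ∀ᶠ u in 𝓝[≥] (t + h), s u = s (t + h) :=
    hs ((isOpen_discrete {s (t + h)}).mem_nhds rfl)
  obtain ⟨u, hu, hsub⟩ := (mem_nhdsGE_iff_exists_Ico_subset).1 h1
  have hlim : Tendsto (fun N : ℕ => t + h + 1 / ((N : ℝ≥0) + 1)) atTop (𝓝 (t + h)) := by
    have := (tendsto_one_div_add_atTop_nhds_zero_nat (𝕜 := ℝ≥0)).const_add (t + h)
    simpa using this
  filter_upwards [hlim.eventually_lt_const hu] with N hN k hk1 hk2
  refine hsub ⟨?_, ?_⟩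
  · rw [add_comm]
    gcongr
  · refine lt_of_le_of_lt ?_ hN
    calc h + k / ((N : ℝ≥0) + 1) ≤ h + (t + 1 / ((N : ℝ≥0) + 1)) := by gcongr
      _ = _ := by ring

/-- Optional stopping is carried out in discrete time on grids of mesh `1 / (N + 1)`;
right-continuity then passes to all times. -/
theorem measure_sumReturnTime_lt_one [IsProbabilityMeasure P] {L M : ℕ → ℝ}
    (hL : ∀ n, 0 < L n) (hbdd : ∃ C : ℝ, ∀ n, L n ≤ C ∧ M n ≤ C)
    {S₁ S₂ : ℝ≥0 → Ω → ℕ}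
    (hS₁ : IsBirthDeathProcess P L M S₁) (hS₂ : IsBirthDeathProcess P L M S₂)
    (hz₁ : ∀ᵐ ω ∂P, S₁ 0 ω = 0) (hz₂ : ∀ᵐ ω ∂P, S₂ 0 ω = 0)
    (hindep : IndepFun (fun ω t => S₁ t ω) (fun ω t => S₂ t ω) P)
    {f : ℕ × ℕ → ℝ} (h0 : ∀ x, 0 ≤ f x) (h1 : ∀ x, f x ≤ 1) (hf : f (0, 0) = 1)
    (hG : ∀ x, bdGenerator₂ L M f x ≤ 0) (hG0 : bdGenerator₂ L M f (0, 0) < 0)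
    {h : ℝ≥0} (hh : 0 < h) :
    P {ω | sumReturnTime S₁ S₂ h ω < ∞} < 1 := by
  obtain ⟨C, hC⟩ := hbdd
  obtain ⟨p₁, hp₁, hM₁⟩ := hS₁.markov
  obtain ⟨p₂, hp₂, hM₂⟩ := hS₂.markov
  have hp := hp₁.isTransitionFunction_prod hp₂
  set p : ℝ≥0 → ℕ × ℕ → ℕ × ℕ → ℝ := fun t x y => p₁ t x.1 y.1 * p₂ t x.2 y.2 with hpdef
  have hx : ∀ x : ℕ × ℕ, x ∈ Finset.range (x.1 + 2) ×ˢ Finset.range (x.2 + 2) := fun x => by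
    simp
  have hC' := neg_bdRate₂_self_le hL hC
  have hG' : ∀ x, ∑ y ∈ Finset.range (x.1 + 2) ×ˢ Finset.range (x.2 + 2),
      bdRate₂ L M x y * f y ≤ 0 := fun x => by
    rw [sum_bdRate₂_mul]
    exact hG x
  have hlt : ∑' y, p h (0, 0) y * f y < 1 := by
    have := hp.tsum_lt h0 h1 hx (sum_bdRate₂ L M) hC' hG' (x := (0, 0))
      (by rw [sum_bdRate₂_mul]; exact hG0) hh
    rwa [hf] at this
  have hsup : ∀ t x, ∑' y, p t x y * f y ≤ f x := fun t x => by
    have := hp.antitone_tsum h0 h1 hx (sum_bdRate₂ L M) hC' hG' x (zero_le (a := t))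
    simpa only [hp.tsum_zero_mul] using this
  have hfabs : ∀ x, |f x| ≤ 1 := fun x => abs_le.2 ⟨by linarith [h0 x], h1 x⟩
  have hofReal : ∀ t x, ∑' y, ENNReal.ofReal (p t x y) * ENNReal.ofReal (f y) =
      ENNReal.ofReal (∑' y, p t x y * f y) := fun t x => by
    rw [ENNReal.ofReal_tsum_of_nonneg (fun y => mul_nonneg (hp.nonneg _ _ _) (h0 y))
      (hp.summable_mul hfabs t x)]
    exact tsum_congr fun y => (ENNReal.ofReal_mul (hp.nonneg _ _ _)).symm
  have hmarkov : ∀ t : ℕ → ℝ≥0, Monotone t → ∀ (n : ℕ) (x : ℕ → ℕ × ℕ),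
      P {ω | ∀ k ≤ n + 1, (S₁ (t k) ω, S₂ (t k) ω) = x k} =
        P {ω | ∀ k ≤ n, (S₁ (t k) ω, S₂ (t k) ω) = x k} *
          ENNReal.ofReal (p (t (n + 1) - t n) (x n) (x (n + 1))) := fun t ht n x => by
    have e₁ := hM₁ n t (fun k => (x k).1) ht
    have e₂ := hM₂ n t (fun k => (x k).2) ht
    rw [measure_pair_path_eq hindep,
      measure_pair_path_eq hindep,
      ← ofReal_measureReal (measure_ne_top _ _), e₁,
      ← ofReal_measureReal (s := {ω | ∀ k ≤ n + 1, S₂ (t k) ω = (x k).2}) (measure_ne_top _ _), e₂,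
      ENNReal.ofReal_mul measureReal_nonneg, ENNReal.ofReal_mul measureReal_nonneg,
      ofReal_measureReal, ofReal_measureReal, ENNReal.ofReal_mul (hp₁.nonneg _ _ _)]
    ring
  -- The first step jumps from `0` to `h`, where the strict loss of mass occurs; afterwards the grid
  -- is uniform. The number of steps in `E` lets the grid reach past time `h + N`.
  let T : ℕ → ℕ → ℝ≥0 := fun N k => if k = 0 then 0 else h + ((k - 1 : ℕ) : ℝ≥0) / ((N : ℝ≥0) + 1)
  have hT : ∀ N, Monotone (T N) := fun N a b hab => by
    simp only [T]
    split_ifs with ha hb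
    · exact le_rfl
    · exact zero_le
    · omega
    · gcongr
  let E : ℕ → Set Ω := fun N => {ω | ∃ k, 0 < k ∧ k ≤ 0 + ((N + 1) * (N + 1) + 2) ∧
    (S₁ (T N k) ω, S₂ (T N k) ω) = (0, 0)}
  have hstart : ∀ᵐ ω ∂P, (S₁ 0 ω, S₂ 0 ω) = (0, 0) := by
    filter_upwards [hz₁, hz₂] with ω ha hb
    rw [ha, hb]
  have hE : ∀ N, P (E N) ≤ ENNReal.ofReal (∑' y, p h (0, 0) y * f y) := fun N => by
    have := measure_prefix_hit_le (P := P) (fun k ω => (S₁ (T N k) ω, S₂ (T N k) ω))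
      (fun n x y => ENNReal.ofReal (p (T N (n + 1) - T N n) x y)) (fun x => ENNReal.ofReal (f x))
      (0, 0) (by simp [hf]) (hmarkov (T N) (hT N)) (fun n x => by
        rw [hofReal]
        exact ENNReal.ofReal_le_ofReal (hsup _ _)) ((N + 1) * (N + 1) + 2) 0 (fun _ => (0, 0))
    rw [hofReal] at this
    have eT : T N (0 + 1) - T N 0 = h := by simp [T]
    rw [eT] at this
    refine le_trans (measure_mono_ae ?_) (this.trans (mul_le_of_le_one_left zero_le prob_le_one))
    filter_upwards [hstart] with ω hω hE
    refine ⟨fun k hk => ?_, hE⟩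
    obtain rfl : k = 0 := by omega
    simpa [T] using hω
  -- A right-continuous path in a discrete space stays at the origin for a while after a visit, so
  -- every sufficiently fine and long grid detects that visit.
  have hsubset : ∀ᵐ ω ∂P, sumReturnTime S₁ S₂ h ω < ∞ → ω ∈ ⋃ m, ⋂ N ≥ m, E N := by
    filter_upwards [hS₁.rightContinuous, hS₂.rightContinuous] with ω hc₁ hc₂ hω
    obtain ⟨t, ht⟩ := iInf_lt_iff.1 hω
    obtain ⟨⟨-, ht0⟩, -⟩ := iInf_lt_iff.1 ht
    have hr₁ := exists_grid_zero (hc₁ (t + h))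
    have hr₂ := exists_grid_zero (hc₂ (t + h))
    obtain ⟨B, hB⟩ := exists_nat_ge t
    obtain ⟨m, hm⟩ := eventually_atTop.1 ((hr₁.and hr₂).and (eventually_ge_atTop B))
    refine Set.mem_iUnion.2 ⟨m, Set.mem_iInter₂.2 fun N hN => ?_⟩
    obtain ⟨⟨a₁, a₂⟩, hBN⟩ := hm N hN
    have hN0 : (0 : ℝ≥0) < (N : ℝ≥0) + 1 := by positivity
    have hk1 : t ≤ (⌈t * ((N : ℝ≥0) + 1)⌉₊ : ℝ≥0) / ((N : ℝ≥0) + 1) := by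
      rw [le_div_iff₀ hN0]
      exact Nat.le_ceil _
    have hk2 : (⌈t * ((N : ℝ≥0) + 1)⌉₊ : ℝ≥0) / ((N : ℝ≥0) + 1) ≤ t + 1 / ((N : ℝ≥0) + 1) := by
      rw [div_le_iff₀ hN0, add_mul, div_mul_cancel₀ _ hN0.ne']
      exact (Nat.ceil_lt_add_one zero_le).le
    have hk3 : ⌈t * ((N : ℝ≥0) + 1)⌉₊ ≤ (N + 1) * (N + 1) := by
      refine Nat.ceil_le.2 ?_
      push_cast
      gcongr
      refine hB.trans ?_
      have : (B : ℝ≥0) ≤ N := by exact_mod_cast hBN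
      exact this.trans (by simp)
    refine ⟨⌈t * ((N : ℝ≥0) + 1)⌉₊ + 1, by omega, by omega, ?_⟩
    have eT : T N (⌈t * ((N : ℝ≥0) + 1)⌉₊ + 1) =
        h + (⌈t * ((N : ℝ≥0) + 1)⌉₊ : ℝ≥0) / ((N : ℝ≥0) + 1) := by
      simp [T]
    rw [eT, a₁ _ hk1 hk2, a₂ _ hk1 hk2, Prod.mk.injEq]
    omega
  have hmono : Monotone fun m => ⋂ N ≥ m, E N := fun a b hab =>
    Set.biInter_mono (fun N (hN : b ≤ N) => hab.trans hN) fun _ _ => le_rfl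
  calc P {ω | sumReturnTime S₁ S₂ h ω < ∞} ≤ P (⋃ m, ⋂ N ≥ m, E N) := measure_mono_ae hsubset
    _ = ⨆ m, P (⋂ N ≥ m, E N) := hmono.measure_iUnion
    _ ≤ ENNReal.ofReal (∑' y, p h (0, 0) y * f y) :=
      iSup_le fun m => (measure_mono (Set.biInter_subset_of_mem (le_refl m))).trans (hE m)
    _ < 1 := by
      rw [← ENNReal.ofReal_one]
      exact (ENNReal.ofReal_lt_ofReal_iff one_pos).2 hlt

end Hitting


/-! ### Reversible measure and growth of the conductances -/

section PotentialTheory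

/-- The reversible measure of the birth-and-death process with rates `L`, `M`. -/
noncomputable def bdMeasure (L M : ℕ → ℝ) (n : ℕ) : ℝ :=
  ∏ k ∈ Finset.range n, L k / M (k + 1)

variable {L M : ℕ → ℝ}

theorem bdMeasure_pos (hL : ∀ n, 0 < L n) (hM : ∀ n, 1 ≤ n → 0 < M n) (n : ℕ) :
    0 < bdMeasure L M n :=
  Finset.prod_pos fun k _ => div_pos (hL k) (hM _ (by omega))

theorem death_mul_bdMeasure_succ (hM : ∀ n, 1 ≤ n → 0 < M n) (n : ℕ) :
    M (n + 1) * bdMeasure L M (n + 1) = L n * bdMeasure L M n := by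
  have := (hM (n + 1) (by omega)).ne'
  rw [bdMeasure, bdMeasure, Finset.prod_range_succ]
  field_simp

/-- Take `1 < r < l` and `β = log r`. Then `(1 + 1 / n) ^ β ≤ exp (β / n)`, whose `n`-th power is
`r`, eventually below `(L n / M n) ^ n`. -/
theorem exists_rpow_le_ratio (hL : ∀ n, 0 < L n) (hM : ∀ n, 1 ≤ n → 0 < M n) {l : ℝ}
    (hlim : Tendsto (fun n : ℕ => (L n / M n) ^ n) atTop (𝓝 l)) (hl : 1 < l) :
    ∃ β : ℝ, 0 < β ∧ ∀ᶠ n : ℕ in atTop, (((n : ℝ) + 1) / n) ^ β ≤ L n / M n := by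
  obtain ⟨r, hr1, hrl⟩ := exists_between hl
  refine ⟨Real.log r, Real.log_pos hr1, ?_⟩
  filter_upwards [hlim.eventually_const_lt hrl, eventually_ge_atTop 1] with n hn hn1
  have hn0 : (0 : ℝ) < n := by exact_mod_cast hn1
  have hρ : 0 < L n / M n := div_pos (hL n) (hM n hn1)
  have hlog : Real.log (((n : ℝ) + 1) / n) ≤ 1 / n := by
    have := Real.log_le_sub_one_of_pos (x := ((n : ℝ) + 1) / n) (by positivity)
    refine this.trans (le_of_eq ?_)
    field_simp
    ring
  have h1 : (((n : ℝ) + 1) / n) ^ Real.log r ≤ Real.exp (Real.log r / n) := by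
    rw [Real.rpow_def_of_pos (by positivity), Real.exp_le_exp]
    calc _ ≤ 1 / n * Real.log r := mul_le_mul_of_nonneg_right hlog (Real.log_pos hr1).le
      _ = _ := by ring
  refine h1.trans ?_
  rw [← pow_le_pow_iff_left₀ (Real.exp_nonneg _) hρ.le (by omega : n ≠ 0), ← Real.exp_nat_mul,
    mul_div_cancel₀ _ hn0.ne', Real.exp_log (by linarith)]
  exact hn.le

/-- By detailed balance `L n * bdMeasure L M n` grows by the factor `L (n + 1) / M (n + 1)`, so its
quotient by `(n + 1) ^ β` is eventually nondecreasing. The constant `K` is the minimum of this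
quotient over the initial segment. -/
theorem exists_rpow_le_birth_mul_bdMeasure (hL : ∀ n, 0 < L n) (hM : ∀ n, 1 ≤ n → 0 < M n) {l : ℝ}
    (hlim : Tendsto (fun n : ℕ => (L n / M n) ^ n) atTop (𝓝 l)) (hl : 1 < l) :
    ∃ β K : ℝ, 0 < β ∧ 0 < K ∧ ∀ n : ℕ, K * ((n : ℝ) + 1) ^ β ≤ L n * bdMeasure L M n := by
  obtain ⟨β, hβ, hev⟩ := exists_rpow_le_ratio hL hM hlim hl
  obtain ⟨n₀, hn₀⟩ := eventually_atTop.1 hev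
  have hpos : ∀ n : ℕ, 0 < L n * bdMeasure L M n / ((n : ℝ) + 1) ^ β := fun n => by
    have := hL n
    have := bdMeasure_pos hL hM n
    positivity
  obtain ⟨m, -, hm⟩ := Finset.exists_min_image (Finset.range (n₀ + 1))
    (fun n : ℕ => L n * bdMeasure L M n / ((n : ℝ) + 1) ^ β) ⟨0, by simp⟩
  refine ⟨β, _, hβ, hpos m, fun n => ?_⟩
  rw [← le_div_iff₀ (by positivity)]
  rcases le_total n n₀ with h | h
  · exact hm n (by simp; omega)
  induction n, h using Nat.le_induction with
  | base => exact hm n₀ (by simp)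
  | succ n hn ih =>
    refine ih.trans ?_
    have hr := hn₀ (n + 1) (by omega)
    have hM1 := hM (n + 1) (by omega)
    have ha := mul_pos (hL n) (bdMeasure_pos hL hM n)
    push_cast at hr ⊢
    rw [div_le_div_iff₀ (by positivity) (by positivity)]
    rw [Real.div_rpow (by positivity) (by positivity), div_le_div_iff₀ (by positivity) hM1] at hr
    have e := death_mul_bdMeasure_succ (L := L) hM n
    have hb := bdMeasure_pos hL hM (n + 1)
    rw [← e]
    calc M (n + 1) * bdMeasure L M (n + 1) * ((n : ℝ) + 1 + 1) ^ β
        = bdMeasure L M (n + 1) * (((n : ℝ) + 1 + 1) ^ β * M (n + 1)) := by ring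
      _ ≤ bdMeasure L M (n + 1) * (L (n + 1) * ((n : ℝ) + 1) ^ β) :=
        mul_le_mul_of_nonneg_left hr hb.le
      _ = _ := by ring

/-! ### The Dirichlet form -/

/-- The summand of the Dirichlet form of the pair of processes, belonging to the two edges that
leave `x` upwards. -/
noncomputable def bdEdgeForm (L M : ℕ → ℝ) (f g : ℕ × ℕ → ℝ) (x : ℕ × ℕ) : ℝ :=
  L x.1 * bdMeasure L M x.1 * bdMeasure L M x.2 *
      ((f x - f (x.1 + 1, x.2)) * (g x - g (x.1 + 1, x.2))) +
    bdMeasure L M x.1 * (L x.2 * bdMeasure L M x.2) *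
      ((f x - f (x.1, x.2 + 1)) * (g x - g (x.1, x.2 + 1)))

/-- The Dirichlet form of the pair of processes, on the triangle `x.1 + x.2 < N`. -/
noncomputable def bdForm (L M : ℕ → ℝ) (N : ℕ) (f g : ℕ × ℕ → ℝ) : ℝ :=
  ∑ n ∈ Finset.range N, ∑ x ∈ Finset.HasAntidiagonal.antidiagonal n, bdEdgeForm L M f g x

theorem bdForm_smul_right (N : ℕ) (f g : ℕ × ℕ → ℝ) (c : ℝ) :
    bdForm L M N f (c • g) = c * bdForm L M N f g := by
  simp only [bdForm, Finset.mul_sum, bdEdgeForm, Pi.smul_apply, smul_eq_mul]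
  refine Finset.sum_congr rfl fun n _ => Finset.sum_congr rfl fun x _ => ?_
  ring

theorem bdForm_sub_right (N : ℕ) (f g g' : ℕ × ℕ → ℝ) :
    bdForm L M N f (g - g') = bdForm L M N f g - bdForm L M N f g' := by
  simp only [bdForm, ← Finset.sum_sub_distrib, bdEdgeForm, Pi.sub_apply]
  refine Finset.sum_congr rfl fun n _ => Finset.sum_congr rfl fun x _ => ?_
  ring

theorem bdForm_add_smul_self (N : ℕ) (f g : ℕ × ℕ → ℝ) (s : ℝ) :
    bdForm L M N (f + s • g) (f + s • g) =
      bdForm L M N f f + 2 * s * bdForm L M N f g + s ^ 2 * bdForm L M N g g := by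
  simp only [bdForm, Finset.mul_sum, ← Finset.sum_add_distrib, bdEdgeForm, Pi.smul_apply,
    Pi.add_apply, smul_eq_mul]
  refine Finset.sum_congr rfl fun n _ => Finset.sum_congr rfl fun x _ => ?_
  ring

theorem continuous_bdForm_self (N : ℕ) : Continuous fun f => bdForm L M N f f := by
  unfold bdForm bdEdgeForm
  fun_prop

theorem sum_antidiagonal_mul_single {N : ℕ} {y : ℕ × ℕ} (hy : y.1 + y.2 < N) (F : ℕ × ℕ → ℝ) :
    ∑ n ∈ Finset.range N, ∑ x ∈ Finset.HasAntidiagonal.antidiagonal n, F x * (if x = y then 1 else 0) = F y := by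
  simp [Finset.HasAntidiagonal.mem_antidiagonal, hy]

/-- Summation by parts: only the edges at `y` contribute, all of them are in the form because `y`
lies inside the triangle, and detailed balance turns birth weights of incoming edges into death
rates at `y`. -/
theorem bdForm_single (hM : ∀ n, 1 ≤ n → 0 < M n) {N : ℕ} {y : ℕ × ℕ} (hy : y.1 + y.2 < N)
    (f : ℕ × ℕ → ℝ) :
    bdForm L M N f (fun x => if x = y then 1 else 0) =
      -(bdMeasure L M y.1 * bdMeasure L M y.2 * bdGenerator₂ L M f y) := by
  obtain ⟨i, j⟩ := y
  let R : ℕ × ℕ → ℝ := fun x => L x.1 * bdMeasure L M x.1 * bdMeasure L M x.2 *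
    (f x - f (x.1 + 1, x.2))
  let U : ℕ × ℕ → ℝ := fun x => bdMeasure L M x.1 * (L x.2 * bdMeasure L M x.2) *
    (f x - f (x.1, x.2 + 1))
  have hsplit : bdForm L M N f (fun x => if x = (i, j) then 1 else 0) =
      (R (i, j) - ∑ n ∈ Finset.range N, ∑ x ∈ Finset.HasAntidiagonal.antidiagonal n,
        R x * (if (x.1 + 1, x.2) = (i, j) then 1 else 0)) +
      (U (i, j) - ∑ n ∈ Finset.range N, ∑ x ∈ Finset.HasAntidiagonal.antidiagonal n,
        U x * (if (x.1, x.2 + 1) = (i, j) then 1 else 0)) := by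
    rw [← sum_antidiagonal_mul_single hy R, ← sum_antidiagonal_mul_single hy U]
    simp only [bdForm, ← Finset.sum_sub_distrib, ← Finset.sum_add_distrib]
    refine Finset.sum_congr rfl fun n _ => Finset.sum_congr rfl fun x _ => ?_
    simp only [bdEdgeForm, R, U]
    ring
  have hR : R (i, j) - ∑ n ∈ Finset.range N, ∑ x ∈ Finset.HasAntidiagonal.antidiagonal n,
        R x * (if (x.1 + 1, x.2) = (i, j) then 1 else 0) =
      -(bdMeasure L M i * bdMeasure L M j * bdGenerator L M (fun k => f (k, j)) i) := by
    rcases i with _ | i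
    · simp [R, bdGenerator]
      ring
    · have e : ∀ x : ℕ × ℕ, ((x.1 + 1, x.2) = (i + 1, j)) = (x = (i, j)) := fun x => by
        simp [Prod.ext_iff]
      simp only [e]
      rw [sum_antidiagonal_mul_single (by simp at hy ⊢; omega)]
      have := death_mul_bdMeasure_succ (L := L) hM i
      simp only [R, bdGenerator, ← this, Nat.add_sub_cancel, Nat.succ_ne_zero, if_false]
      ring
  have hU : U (i, j) - ∑ n ∈ Finset.range N, ∑ x ∈ Finset.HasAntidiagonal.antidiagonal n,
        U x * (if (x.1, x.2 + 1) = (i, j) then 1 else 0) =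
      -(bdMeasure L M i * bdMeasure L M j * bdGenerator L M (fun k => f (i, k)) j) := by
    rcases j with _ | j
    · simp [U, bdGenerator]
      ring
    · have e : ∀ x : ℕ × ℕ, ((x.1, x.2 + 1) = (i, j + 1)) = (x = (i, j)) := fun x => by
        simp [Prod.ext_iff]
      simp only [e]
      rw [sum_antidiagonal_mul_single (by simp at hy ⊢; omega)]
      have := death_mul_bdMeasure_succ (L := L) hM j
      simp only [U, bdGenerator, ← this, Nat.add_sub_cancel, Nat.succ_ne_zero, if_false]
      ring
  rw [hsplit, hR, hU, bdGenerator₂]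
  ring

/-! ### The flow of finite energy -/

/-- The net outflow, across the `n`-th antidiagonal, of the flow which splits at `x` in the
proportion `x.1 + 1 : x.2 + 1` and is uniform on each antidiagonal. -/
theorem antidiagonal_average_sub (f : ℕ × ℕ → ℝ) (n : ℕ) :
    (∑ x ∈ Finset.HasAntidiagonal.antidiagonal n, f x) / ((n : ℝ) + 1) -
        (∑ x ∈ Finset.HasAntidiagonal.antidiagonal (n + 1), f x) / (((n + 1 : ℕ) : ℝ) + 1) =
      ∑ x ∈ Finset.HasAntidiagonal.antidiagonal n,
        (((x.1 : ℝ) + 1) / (((n : ℝ) + 1) * ((n : ℝ) + 2)) * (f x - f (x.1 + 1, x.2)) +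
          ((x.2 : ℝ) + 1) / (((n : ℝ) + 1) * ((n : ℝ) + 2)) * (f x - f (x.1, x.2 + 1))) := by
  have h1 : ∑ x ∈ Finset.HasAntidiagonal.antidiagonal n, ((x.1 : ℝ) + 1) * f (x.1 + 1, x.2) =
      ∑ y ∈ Finset.HasAntidiagonal.antidiagonal (n + 1), (y.1 : ℝ) * f y := by
    rw [Finset.Nat.sum_antidiagonal_succ]
    simp
  have h2 : ∑ x ∈ Finset.HasAntidiagonal.antidiagonal n, ((x.2 : ℝ) + 1) * f (x.1, x.2 + 1) =
      ∑ y ∈ Finset.HasAntidiagonal.antidiagonal (n + 1), (y.2 : ℝ) * f y := by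
    rw [Finset.Nat.sum_antidiagonal_succ']
    simp
  -- The two edges entering `y` carry weights proportional to `y.1` and `y.2`, whose sum `n + 1`
  -- does not depend on `y`: the flow stays uniform.
  have h3 : ∑ y ∈ Finset.HasAntidiagonal.antidiagonal (n + 1), (y.1 : ℝ) * f y +
      ∑ y ∈ Finset.HasAntidiagonal.antidiagonal (n + 1), (y.2 : ℝ) * f y =
      ((n : ℝ) + 1) * ∑ y ∈ Finset.HasAntidiagonal.antidiagonal (n + 1), f y := by
    rw [← Finset.sum_add_distrib, Finset.mul_sum]
    refine Finset.sum_congr rfl fun y hy => ?_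
    have := Finset.HasAntidiagonal.mem_antidiagonal.1 hy
    have : (y.1 : ℝ) + y.2 = n + 1 := by exact_mod_cast this
    rw [← add_mul, this]
  have h4 : ∑ x ∈ Finset.HasAntidiagonal.antidiagonal n, (((x.1 : ℝ) + 1) * f x + ((x.2 : ℝ) + 1) * f x) =
      ((n : ℝ) + 2) * ∑ x ∈ Finset.HasAntidiagonal.antidiagonal n, f x := by
    rw [Finset.mul_sum]
    refine Finset.sum_congr rfl fun y hy => ?_
    have := Finset.HasAntidiagonal.mem_antidiagonal.1 hy
    have : (y.1 : ℝ) + y.2 = n := by exact_mod_cast this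
    rw [← add_mul, ← this]
    ring
  have h5 : ∑ x ∈ Finset.HasAntidiagonal.antidiagonal n,
        (((x.1 : ℝ) + 1) / (((n : ℝ) + 1) * ((n : ℝ) + 2)) * (f x - f (x.1 + 1, x.2)) +
          ((x.2 : ℝ) + 1) / (((n : ℝ) + 1) * ((n : ℝ) + 2)) * (f x - f (x.1, x.2 + 1))) =
      (∑ x ∈ Finset.HasAntidiagonal.antidiagonal n, (((x.1 : ℝ) + 1) * f x + ((x.2 : ℝ) + 1) * f x) -
        (∑ x ∈ Finset.HasAntidiagonal.antidiagonal n, ((x.1 : ℝ) + 1) * f (x.1 + 1, x.2) +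
          ∑ x ∈ Finset.HasAntidiagonal.antidiagonal n, ((x.2 : ℝ) + 1) * f (x.1, x.2 + 1))) /
        (((n : ℝ) + 1) * ((n : ℝ) + 2)) := by
    rw [← Finset.sum_add_distrib, ← Finset.sum_sub_distrib, Finset.sum_div]
    refine Finset.sum_congr rfl fun x _ => ?_
    ring
  rw [h5, h4, h1, h2, h3]
  have : (n : ℝ) + 1 ≠ 0 := by positivity
  have : (n : ℝ) + 2 ≠ 0 := by positivity
  push_cast
  rw [show (n : ℝ) + 1 + 1 = n + 2 by ring]
  field_simp

/-- Young's inequality, by completing a square; `θ` is the flow through an edge, `d` the drop of `f`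
along it and `w` a lower bound for its conductance `c`. -/
theorem mul_le_weighted_sq {θ d w c b s : ℝ} (hθ0 : 0 ≤ θ) (hθ : θ ≤ b) (hw : 0 < w) (hc : w ≤ c)
    (hs : 0 < s) : θ * d ≤ s / 2 * (c * (d * d)) + b ^ 2 / (2 * s * w) := by
  have h1 : θ * d ≤ s / 2 * (w * (d * d)) + θ ^ 2 / (2 * s * w) := by
    have : s / 2 * (w * (d * d)) + θ ^ 2 / (2 * s * w) - θ * d =
        (s * w * d - θ) ^ 2 / (2 * s * w) := by
      field_simp
      ring
    have h2 : 0 ≤ (s * w * d - θ) ^ 2 / (2 * s * w) := by positivity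
    linarith
  refine h1.trans (add_le_add ?_ ?_)
  · have := mul_self_nonneg d
    gcongr
  · gcongr

/-- Thomson's principle: the unit drop of `f` equals its drop integrated against the flow, which
Young's inequality bounds by the Dirichlet form and the energy of the flow. -/
theorem exists_bdForm_lower_bound (hL : ∀ n, 0 < L n) (hM : ∀ n, 1 ≤ n → 0 < M n)
    (hbdd : ∃ C : ℝ, ∀ n, L n ≤ C ∧ M n ≤ C) {l : ℝ}
    (hlim : Tendsto (fun n : ℕ => (L n / M n) ^ n) atTop (𝓝 l)) (hl : 1 < l) :
    ∃ κ : ℝ, 0 < κ ∧ ∀ (N : ℕ) (f : ℕ × ℕ → ℝ), f (0, 0) = 1 →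
      (∀ x, N ≤ x.1 + x.2 → f x = 0) → κ ≤ bdForm L M N f f := by
  obtain ⟨β, K, hβ, hK, ha⟩ := exists_rpow_le_birth_mul_bdMeasure hL hM hlim hl
  obtain ⟨C, hC⟩ := hbdd
  have hC0 : 0 < C := (hL 0).trans_le (hC 0).1
  have hπ := bdMeasure_pos hL hM
  -- Uses `(i + 1) * (j + 1) ≥ i + j + 1`, and `L j ≤ C` to pass from `L j * π j` to `π j`.
  have hbase : ∀ i j n : ℕ, i + j = n → K ^ 2 / C * ((n : ℝ) + 1) ^ β ≤
      L i * bdMeasure L M i * bdMeasure L M j := by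
    rintro i j n rfl
    have h1 : K * ((j : ℝ) + 1) ^ β / C ≤ bdMeasure L M j := by
      rw [div_le_iff₀ hC0]
      refine (ha j).trans ?_
      rw [mul_comm]
      exact mul_le_mul_of_nonneg_left (hC j).1 (hπ j).le
    have h2 : (((i + j : ℕ) : ℝ) + 1) ^ β ≤ ((i : ℝ) + 1) ^ β * ((j : ℝ) + 1) ^ β := by
      rw [← Real.mul_rpow (by positivity) (by positivity)]
      refine Real.rpow_le_rpow (by positivity) ?_ hβ.le
      push_cast
      nlinarith [mul_nonneg (Nat.cast_nonneg (α := ℝ) i) (Nat.cast_nonneg (α := ℝ) j)]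
    calc K ^ 2 / C * (((i + j : ℕ) : ℝ) + 1) ^ β
        ≤ K ^ 2 / C * (((i : ℝ) + 1) ^ β * ((j : ℝ) + 1) ^ β) := by gcongr
      _ = (K * ((i : ℝ) + 1) ^ β) * (K * ((j : ℝ) + 1) ^ β / C) := by ring
      _ ≤ _ := mul_le_mul (ha i) h1 (by positivity) (mul_pos (hL i) (hπ i)).le
  have hsummable : Summable fun n : ℕ => 1 / (((n : ℝ) + 1) * (K ^ 2 / C * ((n : ℝ) + 1) ^ β)) := by
    have h1 : Summable fun n : ℕ => 1 / ((n : ℝ) ^ (1 + β)) :=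
      Real.summable_one_div_nat_rpow.2 (by linarith)
    have h2 := ((summable_nat_add_iff 1).2 h1).mul_left (1 / (K ^ 2 / C))
    refine h2.congr fun n => ?_
    have hn : (0 : ℝ) < (n : ℝ) + 1 := by positivity
    push_cast
    rw [Real.rpow_add hn, Real.rpow_one]
    field_simp
  set Z := ∑' n : ℕ, 1 / (((n : ℝ) + 1) * (K ^ 2 / C * ((n : ℝ) + 1) ^ β)) with hZ
  have hZpos : 0 < Z := hsummable.tsum_pos (fun n => by positivity) 0 (by positivity)
  refine ⟨1 / (2 * Z), by positivity, fun N f hf0 hfN => ?_⟩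
  let A : ℕ → ℝ := fun n => (∑ x ∈ Finset.HasAntidiagonal.antidiagonal n, f x) / ((n : ℝ) + 1)
  have hA0 : A 0 = 1 := by simp [A, hf0]
  have hAN : A N = 0 := by
    simp only [A]
    rw [Finset.sum_eq_zero, zero_div]
    intro x hx
    exact hfN x (Finset.HasAntidiagonal.mem_antidiagonal.1 hx).ge
  have htel : ∑ n ∈ Finset.range N, (A n - A (n + 1)) = 1 := by
    rw [Finset.sum_range_sub', hA0, hAN, sub_zero]
  -- The Young parameter `s = 2 * Z` makes the energy terms add up to at most `1 / 2`, leaving half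
  -- of the unit drop to the Dirichlet form.
  have hlayer : ∀ n, A n - A (n + 1) ≤
      Z * ∑ x ∈ Finset.HasAntidiagonal.antidiagonal n, bdEdgeForm L M f f x +
        1 / (2 * Z) * (1 / (((n : ℝ) + 1) * (K ^ 2 / C * ((n : ℝ) + 1) ^ β))) := fun n => by
    have hw : 0 < K ^ 2 / C * ((n : ℝ) + 1) ^ β := by positivity
    have hpt : ∀ x ∈ Finset.HasAntidiagonal.antidiagonal n,
        (((x.1 : ℝ) + 1) / (((n : ℝ) + 1) * ((n : ℝ) + 2)) * (f x - f (x.1 + 1, x.2)) +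
          ((x.2 : ℝ) + 1) / (((n : ℝ) + 1) * ((n : ℝ) + 2)) * (f x - f (x.1, x.2 + 1))) ≤
        Z * bdEdgeForm L M f f x +
          1 / (2 * Z) * ((1 / ((n : ℝ) + 1)) ^ 2 / (K ^ 2 / C * ((n : ℝ) + 1) ^ β)) := by
      intro x hx
      have hxn := Finset.HasAntidiagonal.mem_antidiagonal.1 hx
      have hθ : ∀ i : ℕ, i ≤ n → ((i : ℝ) + 1) / (((n : ℝ) + 1) * ((n : ℝ) + 2)) ≤
          1 / ((n : ℝ) + 1) := fun i hi => by
        have : (i : ℝ) ≤ n := by exact_mod_cast hi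
        rw [div_le_div_iff₀ (by positivity) (by positivity)]
        have h0 : (0 : ℝ) ≤ n := by positivity
        nlinarith
      have b1 := mul_le_weighted_sq (d := f x - f (x.1 + 1, x.2)) (by positivity)
        (hθ x.1 (by omega)) hw (hbase x.1 x.2 n hxn) (s := 2 * Z) (by positivity)
      have b2 := mul_le_weighted_sq (d := f x - f (x.1, x.2 + 1)) (by positivity)
        (hθ x.2 (by omega)) hw (hbase x.2 x.1 n (by omega)) (s := 2 * Z) (by positivity)
      refine (add_le_add b1 b2).trans (le_of_eq ?_)
      simp only [bdEdgeForm]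
      field_simp
      ring
    have := Finset.sum_le_sum hpt
    rw [← antidiagonal_average_sub, Finset.sum_add_distrib, ← Finset.mul_sum, Finset.sum_const,
      Finset.Nat.card_antidiagonal, nsmul_eq_mul] at this
    refine this.trans (le_of_eq ?_)
    push_cast
    field_simp
  have hsum := Finset.sum_le_sum fun n (_ : n ∈ Finset.range N) => hlayer n
  rw [htel, Finset.sum_add_distrib, ← Finset.mul_sum, ← Finset.mul_sum] at hsum
  have hpart := hsummable.sum_le_tsum (Finset.range N) fun n _ => by positivity
  have h2 : 1 / (2 * Z) * ∑ n ∈ Finset.range N,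
      1 / (((n : ℝ) + 1) * (K ^ 2 / C * ((n : ℝ) + 1) ^ β)) ≤ 1 / 2 := by
    calc _ ≤ 1 / (2 * Z) * Z := by gcongr
      _ = 1 / 2 := by field_simp
  have h3 : 1 / 2 ≤ Z * bdForm L M N f f := by
    change 1 ≤ Z * bdForm L M N f f + _ at hsum
    linarith
  rw [div_le_iff₀ (by positivity)]
  linarith

/-! ### Superharmonic functions from energy minimisation -/

/-- The function minimising the Dirichlet form among `[0, 1]`-valued functions equal to `1` at the
origin and supported on a triangle. -/
theorem exists_superharmonic_triangle (hL : ∀ n, 0 < L n) (hM : ∀ n, 1 ≤ n → 0 < M n) {N : ℕ}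
    (hN : 0 < N) :
    ∃ f : ℕ × ℕ → ℝ, (∀ x, f x ∈ Set.Icc 0 1) ∧ f (0, 0) = 1 ∧
      (∀ x, N ≤ x.1 + x.2 → f x = 0) ∧
      (∀ x, x.1 + x.2 < N → bdGenerator₂ L M f x ≤ 0) ∧
      bdForm L M N f f ≤ -bdGenerator₂ L M f (0, 0) := by
  let S : Set (ℕ × ℕ → ℝ) := {f | (∀ x, f x ∈ Set.Icc 0 1) ∧ f (0, 0) = 1 ∧
    ∀ x, N ≤ x.1 + x.2 → f x = 0}
  let δ : ℕ × ℕ → ℕ × ℕ → ℝ := fun y x => if x = y then 1 else 0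
  have hδS : δ (0, 0) ∈ S := by
    refine ⟨fun x => ?_, by simp [δ], fun x hx => ?_⟩
    · simp only [δ]
      split_ifs <;> simp
    · have : x ≠ (0, 0) := by
        rintro rfl
        simp at hx
        omega
      simp [δ, this]
  have hcompact : IsCompact S := by
    have hcl : IsClosed {f : ℕ × ℕ → ℝ | f (0, 0) = 1 ∧ ∀ x, N ≤ x.1 + x.2 → f x = 0} := by
      have e : {f : ℕ × ℕ → ℝ | ∀ x, N ≤ x.1 + x.2 → f x = 0} =
          ⋂ x : ℕ × ℕ, ⋂ (_ : N ≤ x.1 + x.2), {f | f x = 0} := by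
        ext f
        simp
      refine IsClosed.inter (isClosed_eq (by fun_prop) continuous_const) ?_
      change IsClosed {f : ℕ × ℕ → ℝ | ∀ x, N ≤ x.1 + x.2 → f x = 0}
      rw [e]
      exact isClosed_iInter fun x => isClosed_iInter fun _ =>
        isClosed_eq (by fun_prop) continuous_const
    have := (isCompact_univ_pi fun _ : ℕ × ℕ => isCompact_Icc (a := (0 : ℝ)) (b := 1)).inter_right
      hcl
    convert this using 1
    ext f
    simp only [S, Set.mem_inter_iff, Set.mem_univ_pi, Set.mem_ofPred_eq]
  obtain ⟨f, hfS, hmin⟩ := hcompact.exists_isMinOn ⟨_, hδS⟩ (continuous_bdForm_self (L := L) (M := M)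
    N).continuousOn
  -- First-order condition for a minimum on a convex set: compare with the segment from `f` to `g`,
  -- divide by its parameter and let that tend to `0`.
  have hvar : ∀ g ∈ S, 0 ≤ bdForm L M N f (g - f) := by
    intro g hg
    have hseg : ∀ s ∈ Set.Ioc (0 : ℝ) 1, 0 ≤ 2 * bdForm L M N f (g - f) +
        s * bdForm L M N (g - f) (g - f) := by
      rintro s ⟨hs0, hs1⟩
      have hmem : f + s • (g - f) ∈ S := by
        refine ⟨fun x => ?_, ?_, fun x hx => ?_⟩
        · have h1 := hfS.1 x
          have h2 := hg.1 x
          simp only [Pi.add_apply, Pi.smul_apply, Pi.sub_apply, smul_eq_mul]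
          constructor
          · nlinarith [mul_nonneg hs0.le h2.1, mul_nonneg (sub_nonneg.2 hs1) h1.1]
          · nlinarith [mul_nonneg hs0.le (sub_nonneg.2 h2.2),
              mul_nonneg (sub_nonneg.2 hs1) (sub_nonneg.2 h1.2)]
        · simp [hfS.2.1, hg.2.1]
        · simp [hfS.2.2 x hx, hg.2.2 x hx]
      have := hmin hmem
      simp only [Set.mem_ofPred_eq, bdForm_add_smul_self] at this
      by_contra hneg
      nlinarith
    have hlim : Tendsto (fun s : ℝ => 2 * bdForm L M N f (g - f) +
        s * bdForm L M N (g - f) (g - f)) (𝓝[>] 0) (𝓝 (2 * bdForm L M N f (g - f))) := by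
      have : Continuous fun s : ℝ => 2 * bdForm L M N f (g - f) +
        s * bdForm L M N (g - f) (g - f) := by fun_prop
      have := (this.tendsto 0).mono_left (nhdsWithin_le_nhds (s := Set.Ioi 0))
      simpa using this
    have hev : ∀ᶠ s : ℝ in 𝓝[>] 0, 0 ≤ 2 * bdForm L M N f (g - f) +
        s * bdForm L M N (g - f) (g - f) := by
      filter_upwards [Ioc_mem_nhdsGT (zero_lt_one (α := ℝ))] with s hs using hseg s hs
    linarith [ge_of_tendsto hlim hev]
  have hm0 : bdMeasure L M 0 = 1 := by simp [bdMeasure]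
  have hform0 := bdForm_single (L := L) hM (y := (0, 0)) (N := N) (by simpa using hN) f
  simp only [hm0, one_mul] at hform0
  -- The competitor is the indicator of the origin.
  have horigin : bdForm L M N f f ≤ -bdGenerator₂ L M f (0, 0) := by
    have := hvar _ hδS
    rw [bdForm_sub_right] at this
    rw [← hform0]
    simp only [δ] at this
    linarith
  refine ⟨f, hfS.1, hfS.2.1, hfS.2.2, fun x hx => ?_, horigin⟩
  -- Where `f` attains its maximum `1`, in particular at the origin, the generator is nonpositive
  -- for any rates. Elsewhere raising `f x` to `1` is admissible and the first-order condition
  -- applies.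
  by_cases h1 : f x = 1
  · have hle : ∀ y, f y ≤ 1 := fun y => (hfS.1 y).2
    have hgen : ∀ (g : ℕ → ℝ) (i : ℕ), g i = 1 → (∀ k, g k ≤ 1) → bdGenerator L M g i ≤ 0 := by
      intro g i hi hg
      rw [bdGenerator, hi]
      have e1 := mul_nonneg (hL i).le (sub_nonneg.2 (hg (i + 1)))
      split_ifs with h0
      · linarith
      · have e2 := mul_nonneg (hM i (by omega)).le (sub_nonneg.2 (hg (i - 1)))
        linarith
    exact add_nonpos (hgen _ _ h1 fun k => hle _) (hgen _ _ h1 fun k => hle _)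
  · have hlt : f x < 1 := lt_of_le_of_ne (hfS.1 x).2 h1
    have hmem : f + (1 - f x) • δ x ∈ S := by
      have hval : ∀ z, (f + (1 - f x) • δ x) z = if z = x then 1 else f z := fun z => by
        by_cases hz : z = x
        · subst hz
          simp [δ]
        · simp [δ, hz]
      refine ⟨fun z => ?_, ?_, fun z hz => ?_⟩
      · rw [hval]
        split_ifs
        · simp
        · exact hfS.1 z
      · rw [hval, hfS.2.1]
        simp
      · have : z ≠ x := by
          rintro rfl
          omega
        rw [hval, if_neg this, hfS.2.2 z hz]
    have := hvar _ hmem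
    rw [add_sub_cancel_left, bdForm_smul_right, bdForm_single hM hx] at this
    have h2 := nonneg_of_mul_nonneg_right this (sub_pos.2 hlt)
    have h3 := mul_pos (bdMeasure_pos hL hM x.1) (bdMeasure_pos hL hM x.2)
    by_contra hneg
    nlinarith [mul_pos h3 (not_le.1 hneg)]

theorem continuous_bdGenerator₂ (x : ℕ × ℕ) : Continuous fun f => bdGenerator₂ L M f x := by
  obtain ⟨i, j⟩ := x
  unfold bdGenerator₂ bdGenerator
  rcases i with _ | i <;> rcases j with _ | j <;> simp <;> fun_prop

/-- If `(L n / M n) ^ n` tends to a limit above `1`, there is a non-constant superharmonic function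
for the pair of processes with its maximum at the origin. -/
theorem exists_superharmonic (hL : ∀ n, 0 < L n) (hM : ∀ n, 1 ≤ n → 0 < M n)
    (hbdd : ∃ C : ℝ, ∀ n, L n ≤ C ∧ M n ≤ C) {l : ℝ}
    (hlim : Tendsto (fun n : ℕ => (L n / M n) ^ n) atTop (𝓝 l)) (hl : 1 < l) :
    ∃ f : ℕ × ℕ → ℝ, (∀ x, f x ∈ Set.Icc 0 1) ∧ f (0, 0) = 1 ∧
      (∀ x, bdGenerator₂ L M f x ≤ 0) ∧ bdGenerator₂ L M f (0, 0) < 0 := by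
  obtain ⟨κ, hκ, hform⟩ := exists_bdForm_lower_bound hL hM hbdd hlim hl
  choose F hF01 hF0 hFN hFG hFE using fun N : ℕ =>
    exists_superharmonic_triangle (L := L) hL hM (Nat.succ_pos N)
  -- Pointwise convergence suffices, since the generator at a point involves finitely many values;
  -- the uniform `κ` keeps it strictly negative at the origin.
  obtain ⟨f, hf, φ, hφ, hconv⟩ := (isCompact_univ_pi fun _ : ℕ × ℕ =>
    isCompact_Icc (a := (0 : ℝ)) (b := 1)).tendsto_subseq (x := F) fun N => by
      simpa only [Set.mem_univ_pi] using hF01 N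
  have hG : ∀ x, Tendsto (fun n => bdGenerator₂ L M (F (φ n)) x) atTop
      (𝓝 (bdGenerator₂ L M f x)) := fun x => ((continuous_bdGenerator₂ x).tendsto f).comp hconv
  refine ⟨f, Set.mem_univ_pi.1 hf, ?_, fun x => ?_, ?_⟩
  · have h1 : Tendsto (fun n => F (φ n) (0, 0)) atTop (𝓝 (f (0, 0))) :=
      ((continuous_apply (0, 0)).tendsto f).comp hconv
    simp only [hF0] at h1
    exact tendsto_nhds_unique h1 tendsto_const_nhds |>.symm ▸ rfl
  · refine le_of_tendsto (hG x) ?_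
    filter_upwards [eventually_ge_atTop (x.1 + x.2)] with n hn
    have := hφ.id_le n
    simp only [id] at this
    exact hFG (φ n) x (by omega)
  · refine lt_of_le_of_lt (le_of_tendsto' (hG (0, 0)) fun n => ?_) (neg_lt_zero.2 hκ)
    have := hform _ _ (hF0 (φ n)) (hFN (φ n))
    linarith [hFE (φ n)]

end PotentialTheory


theorem theorem7 {Ω : Type*} [MeasurableSpace Ω] (P : Measure Ω) [IsProbabilityMeasure P]
    (L M : ℕ → ℝ) (hL : ∀ n, 0 < L n) (hM : ∀ n, 1 ≤ n → 0 < M n)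
    (hbdd : ∃ C : ℝ, ∀ n, L n ≤ C ∧ M n ≤ C)
    (S₁ S₂ : ℝ≥0 → Ω → ℕ)
    (hS₁ : IsBirthDeathProcess P L M S₁) (hS₂ : IsBirthDeathProcess P L M S₂)
    (hS₁_zero : ∀ᵐ ω ∂P, S₁ 0 ω = 0) (hS₂_zero : ∀ᵐ ω ∂P, S₂ 0 ω = 0)
    (hindep : IndepFun (fun ω t => S₁ t ω) (fun ω t => S₂ t ω) P)
    (hnull₁ : IsNullRecurrentAtZero P S₁) (hnull₂ : IsNullRecurrentAtZero P S₂)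
    (l : ℝ) (hlim : Tendsto (fun n : ℕ => (L n / M n) ^ n) atTop (𝓝 l)) (hl : 1 < l)
    (h : ℝ≥0) (hh : 0 < h) :
    P {ω | sumReturnTime S₁ S₂ h ω < ∞} < 1 := by
  obtain ⟨f, hf01, hf0, hG, hG0⟩ := exists_superharmonic hL hM hbdd hlim hl
  exact measure_sumReturnTime_lt_one hL hbdd hS₁ hS₂ hS₁_zero hS₂_zero hindep
    (fun x => (hf01 x).1) (fun x => (hf01 x).2) hf0 hG hG0 hh
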